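/- Let $A$ be a unital separable C*-algebra and let $\varphi_n : A \to M_{k_n}(\mathbb{C})$ ($n\in\mathbb{N}$) be a sequence of unital completely positive maps, with multiplicative domains $$A_{\varphi_n}=\{a\in A : \varphi_n(a^*a)=\varphi_n(a)^*\varphi_n(a)\ \text{and}\ \varphi_n(aa^*)=\varphi_n(a)\varphi_n(a)^*\},$$ such that for every $a\in A$ $$\lim_{n\to\infty}\|\varphi_n(a)\| = \|a\| \quad\text{and}\quad \lim_{n\to\infty}\operatorname{dist}(a, A_{\varphi_n}) = 0 .$$ Let $\alpha$ be an action of a finite group $G$ on $A$ by $*$-automorphisms such that $\alpha_g(A_{\varphi_n}) = A_{\varphi_n}$ for all $n\in\mathbb{N}$ and $g\in G$. Let $A\rtimes_\alpha G$ be the crossed product, i.e. the C*-subalgebra of $A\otimes B(\ell^2(G))\cong M_{|G|}(A)$ generated by the elements $\sum_{g\in G}\alpha_g^{-1}(a)\otimes e_{g,g}$ ($a\in A$) and $1\otimes\lambda_h$ ($h\in G$), where the $e_{s,t}$ are the canonical matrix units of $B(\ell^2(G))$ and $\lambda$ is the left regular representation of $G$. Then $A\rtimes_\alpha G$ is inner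 quasidiagonal: for all $x_1,\dots,x_m\in A\rtimes_\alpha G$ and $\varepsilon>0$ there are a representation $\pi$ of $A\rtimes_\alpha G$ on a Hilbert space and a finite-rank projection $P\in\pi(A\rtimes_\alpha G)''$ such that $\|P\pi(x_i)-\pi(x_i)P\|<\varepsilon$ and $\|P\pi(x_i)P\|>\|x_i\|-\varepsilon$ for $1\le i\le m$. -/

import Mathlib

open Filter Topology
open scoped ComplexOrder CStarAlgebra

noncomputable section

universe u v

/-- A C⋆-algebra `A` is inner quasidiagonal if for all `x₁, …, xₙ ∈ A` and `ε > 0` there are a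
representation `π` of `A` on a Hilbert space `H` and a finite-rank projection `P` in the double
commutant `π(A)''` such that `‖P π(xᵢ) - π(xᵢ) P‖ < ε` and `‖P π(xᵢ) P‖ > ‖xᵢ‖ - ε` for all `i`.
(Taking `H` in the universe of `A` loses nothing: one may always cut down to the closed
`π(A)`-invariant subspace generated by the range of `P`.) -/
def InnerQuasidiagonal (A : Type u) [NonUnitalCStarAlgebra A] : Prop :=
  ∀ (n : ℕ) (x : Fin n → A) (ε : ℝ), 0 < ε →
    ∃ (H : Type u) (_ : NormedAddCommGroup H) (_ : InnerProductSpace ℂ H) (_ : CompleteSpace H)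
      (π : A →⋆ₙₐ[ℂ] (H →L[ℂ] H)) (P : H →L[ℂ] H),
      IsStarProjection P ∧
      FiniteDimensional ℂ P.range ∧
      P ∈ Set.centralizer (Set.centralizer (Set.range π)) ∧
      ∀ i, ‖P * π (x i) - π (x i) * P‖ < ε ∧ ‖x i‖ - ε < ‖P * π (x i) * P‖

/-- The multiplicative domain of a map `φ : A → B` (used for unital completely positive `φ`). -/
def multiplicativeDomain {A : Type u} {B : Type v} [Mul A] [Star A] [Mul B] [Star B]
    (φ : A → B) : Set A :=
  {a | φ (star a * a) = star (φ a) * φ a ∧ φ (a * star a) = φ a * star (φ a)}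

/-- The C⋆-algebra `M_k(ℂ)` of complex `k × k` matrices, with the operator norm. -/
abbrev MatrixAlgebra (k : ℕ) : Type := CStarMatrix (Fin k) (Fin k) ℂ

section CrossedProduct

variable {A : Type u} [CStarAlgebra A] [PartialOrder A] [StarOrderedRing A]
variable {G : Type v} [Group G] [Fintype G] [DecidableEq G]

/-- The element `∑_g α_g⁻¹(a) ⊗ e_{g,g}` of `A ⊗ B(ℓ²(G)) = M_G(A)`. -/
def covariantCoeff (α : G →* (A ≃⋆ₐ[ℂ] A)) (a : A) : CStarMatrix G G A :=
  CStarMatrix.ofMatrix (Matrix.diagonal fun g => (α g)⁻¹ a)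

variable (A) in
/-- The element `1 ⊗ λ_h` of `A ⊗ B(ℓ²(G)) = M_G(A)`, where `λ_h δ_t = δ_{ht}`. -/
def covariantUnitary (h : G) : CStarMatrix G G A :=
  CStarMatrix.ofMatrix (Matrix.of fun s t => if s = h * t then 1 else 0)

/-- The crossed product `A ⋊_α G` by an action of a finite group: the C⋆-subalgebra of
`A ⊗ B(ℓ²(G)) = M_G(A)` generated by the elements `∑_g α_g⁻¹(a) ⊗ e_{g,g}` for `a ∈ A` and
`1 ⊗ λ_h` for `h ∈ G`. -/
def CrossedProduct (α : G →* (A ≃⋆ₐ[ℂ] A)) : StarSubalgebra ℂ (CStarMatrix G G A) :=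
  (StarAlgebra.adjoin ℂ
    (Set.range (covariantCoeff α) ∪ Set.range (covariantUnitary A (G := G)))).topologicalClosure

instance CrossedProduct.instCStarAlgebra (α : G →* (A ≃⋆ₐ[ℂ] A)) :
    CStarAlgebra (CrossedProduct α) :=
  StarSubalgebra.cstarAlgebra (CrossedProduct α)
    (h_closed := StarSubalgebra.isClosed_topologicalClosure _)

end CrossedProduct

end

/-! Let `Ψₙ` be the entrywise amplification of `φₙ` to `M_G(A)`, and let `Eₙ ⊆ A ⋊ G` consist of
the elements with entries in the multiplicative domain of `φₙ`. As this domain is `α`-invariant,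
the `Eₙ` asymptotically exhaust `A ⋊ G`, and `Ψₙ` is multiplicative on `Eₙ`. Along any
ultrafilter `lim ‖Ψₙ x‖` is a C⋆-norm on `M_G(A)`, so by uniqueness of C⋆-norms the `Ψₙ` are
asymptotically isometric.

To realize such a `Ψₙ` by a projection in a bicommutant, choose `d₁, …, dₘ ∈ Eₙ` close to the
given elements. States norming the `Ψₙ(dᵢ)⋆ Ψₙ(dᵢ)` pull back to states of `A ⋊ G` that vanish
at `d⋆ d` whenever `d ∈ Eₙ` and `Ψₙ(d) = 0`, and by Krein–Milman these may be replaced by pure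
states. Let `π` be the direct sum of their GNS representations. Its commutant is
finite-dimensional by Schur's lemma, and `Eₙ` moves each cyclic vector inside a
finite-dimensional subspace, because `Ψₙ` has finite-dimensional range. The translates of these
subspaces under the commutant span a finite-dimensional space invariant under both the commutant
and `π(Eₙ)`. The projection onto it lies in `π(A ⋊ G)''`, commutes with the `π(dᵢ)`, and
compresses `π(dᵢ)` to norm at least `‖Ψₙ(dᵢ)‖`. -/

universe u v

section PositiveMaps

variable {B : Type*} [CStarAlgebra B] [PartialOrder B] [StarOrderedRing B]
  {C : Type*} [CStarAlgebra C] [PartialOrder C] [StarOrderedRing C]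

/-- The positive map given by a linear map that is nonnegative on the elements `b⋆ b`, which are
all the nonnegative elements of a C⋆-algebra. -/
noncomputable def positiveOfStarMulSelf (f : B →ₗ[ℂ] C) (hf : ∀ b, 0 ≤ f (star b * b)) :
    B →ₚ[ℂ] C :=
  .mk₀ f fun _ ha => by
    obtain ⟨b, rfl⟩ := CStarAlgebra.nonneg_iff_eq_star_mul_self.mp ha
    exact hf b

@[simp]
lemma positiveOfStarMulSelf_apply (f : B →ₗ[ℂ] C) (hf : ∀ b, 0 ≤ f (star b * b)) (b : B) :
    positiveOfStarMulSelf f hf b = f b := rfl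

/- The sharp constant is `1` (Russo–Dye), but `4` is immediate from writing `b` as a combination of
four nonnegative elements. -/
lemma norm_map_le_four_mul_norm (f : B →ₚ[ℂ] C) (hf : ‖f 1‖ ≤ 1) (b : B) : ‖f b‖ ≤ 4 * ‖b‖ := by
  obtain ⟨y, hy_nonneg, hy_norm, hy⟩ := CStarAlgebra.exists_sum_four_nonneg b
  have hfy (i) : ‖f (y i)‖ ≤ ‖b‖ := calc
    ‖f (y i)‖ ≤ ‖f 1‖ * ‖y i‖ := f.norm_apply_le_of_nonneg _ (hy_nonneg i)
    _ ≤ 1 * ‖b‖ := by gcongr; exact hy_norm i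
    _ = ‖b‖ := one_mul _
  calc ‖f b‖ = ‖∑ i : Fin 4, Complex.I ^ (i : ℕ) • f (y i)‖ := by
        conv_lhs => rw [hy]
        simp only [map_sum, map_smul]
    _ ≤ ∑ _i : Fin 4, ‖b‖ := norm_sum_le_of_le _ fun i _ => by
        simpa only [norm_smul, norm_pow, Complex.norm_I, one_pow, one_mul] using hfy i
    _ = 4 * ‖b‖ := by simp

lemma norm_map_mul_sub_le (f : B →ₚ[ℂ] C) (hf : ‖f 1‖ ≤ 1) {x d : B}
    (hd : f (x * d) = f x * f d) (y : B) :
    ‖f (x * y) - f x * f y‖ ≤ 20 * ‖x‖ * ‖y - d‖ := by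
  have hb := norm_map_le_four_mul_norm f hf
  calc ‖f (x * y) - f x * f y‖ = ‖f (x * (y - d)) - f x * f (y - d)‖ := by
        rw [mul_sub, map_sub, map_sub, mul_sub, hd, sub_sub_sub_cancel_right]
    _ ≤ 4 * (‖x‖ * ‖y - d‖) + 4 * ‖x‖ * (4 * ‖y - d‖) :=
        norm_sub_le_of_le ((hb _).trans (by gcongr; exact norm_mul_le _ _))
          (norm_mul_le_of_le (hb _) (hb _))
    _ = 20 * ‖x‖ * ‖y - d‖ := by ring

lemma im_apply_eq_zero_of_norm_le_one {f : StrongDual ℂ C} (hf : ‖f‖ ≤ 1) (hf1 : f 1 = 1) {a : C}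
    (ha : IsSelfAdjoint a) : (f a).im = 0 := by
  have hbound (t : ℝ) : ((f a).im + t) ^ 2 ≤ ‖a‖ ^ 2 + t ^ 2 := by
    have hnorm : ‖a + (t * Complex.I) • (1 : C)‖ ^ 2 ≤ ‖a‖ ^ 2 + t ^ 2 := calc
      ‖a + (t * Complex.I) • (1 : C)‖ ^ 2 = ‖a * a + ((t ^ 2 : ℝ) : ℂ) • (1 : C)‖ := by
        rw [sq, ← CStarRing.norm_star_mul_self]
        congr 1
        simp only [star_add, star_smul, star_one, ha.star_eq, add_mul, mul_add, smul_mul_assoc,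
          mul_smul_comm, one_mul, mul_one, smul_add, smul_smul, RCLike.star_def, map_mul,
          Complex.conj_ofReal, Complex.conj_I, Complex.ofReal_pow]
        rw [show t * Complex.I * (t * -Complex.I) = (t : ℂ) ^ 2 by
          linear_combination (-t ^ 2 : ℂ) * Complex.I_sq]
        module
      _ ≤ ‖a‖ * ‖a‖ + t ^ 2 * 1 := norm_add_le_of_le (norm_mul_le _ _) <| by
        rw [norm_smul, Complex.norm_real, Real.norm_of_nonneg (sq_nonneg t)]
        gcongr
        exact (CStarAlgebra.norm_le_one_iff_of_nonneg 1).mpr le_rfl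
      _ = _ := by ring
    calc ((f a).im + t) ^ 2 = (f (a + (t * Complex.I) • (1 : C))).im ^ 2 := by simp [hf1]
      _ ≤ ‖f (a + (t * Complex.I) • (1 : C))‖ ^ 2 := by
        rw [← sq_abs]; gcongr; exact Complex.abs_im_le_norm _
      _ ≤ ‖a + (t * Complex.I) • (1 : C)‖ ^ 2 := by
        gcongr; exact f.le_of_opNorm_le_of_le hf le_rfl |>.trans_eq (one_mul _)
      _ ≤ _ := hnorm
  by_contra him
  have hcancel : (f a).im * (‖a‖ ^ 2 / (f a).im) = ‖a‖ ^ 2 := mul_div_cancel₀ _ him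
  nlinarith [hbound (‖a‖ ^ 2 / (f a).im), sq_pos_of_ne_zero him, sq_nonneg ‖a‖]

lemma apply_nonneg_of_norm_le_one {f : StrongDual ℂ C} (hf : ‖f‖ ≤ 1) (hf1 : f 1 = 1) {a : C}
    (ha : 0 ≤ a) : 0 ≤ f a := by
  have hnorm : ‖algebraMap ℝ C ‖a‖ - a‖ ≤ ‖a‖ := by
    refine ((CStarAlgebra.mem_Icc_algebraMap_iff_norm_le (norm_nonneg a)).mp ⟨?_, ?_⟩).2
    · exact sub_nonneg.mpr (IsSelfAdjoint.of_nonneg ha).le_algebraMap_norm_self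
    · exact sub_le_self _ ha
  have hre : ‖a‖ - (f a).re ≤ ‖a‖ := calc
    ‖a‖ - (f a).re = (f (algebraMap ℝ C ‖a‖ - a)).re := by
      simp [Algebra.algebraMap_eq_smul_one, hf1]
    _ ≤ ‖f (algebraMap ℝ C ‖a‖ - a)‖ := Complex.re_le_norm _
    _ ≤ 1 * ‖a‖ := f.le_of_opNorm_le_of_le hf hnorm
    _ = ‖a‖ := one_mul _
  exact Complex.nonneg_iff.mpr
    ⟨by linarith, (im_apply_eq_zero_of_norm_le_one hf hf1 (.of_nonneg ha)).symm⟩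

lemma eq_ofReal_of_norm_le_of_le_re {z : ℂ} {r : ℝ} (hz : ‖z‖ ≤ r) (hr : r ≤ z.re) : z = r := by
  have hre : z.re = r := le_antisymm ((Complex.re_le_norm z).trans hz) hr
  rw [← hre]
  exact (RCLike.re_eq_self_of_le (hz.trans hr)).symm

/- A norming functional `g` of `1 + a` satisfies `g 1 + g a = 1 + ‖a‖`, which forces both `g 1 = 1`
and `g a = ‖a‖`. -/
lemma exists_state_apply_eq_norm [Nontrivial C] {a : C} (ha : 0 ≤ a) :
    ∃ g : C →ₚ[ℂ] ℂ, g 1 = 1 ∧ g a = ‖a‖ := by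
  have hnorm : 1 + ‖a‖ ≤ ‖1 + a‖ := by
    have hmem : 1 + ‖a‖ ∈ spectrum ℝ (1 + a) := by
      rw [← map_one (algebraMap ℝ C), add_comm (1 : ℝ), spectrum.add_mem_add_iff]
      exact CStarAlgebra.norm_mem_spectrum_of_nonneg ha
    exact (Real.le_norm_self _).trans (spectrum.norm_le_norm_of_mem hmem)
  obtain ⟨g, hg, hga⟩ := exists_dual_vector ℂ (1 + a) (by linarith [norm_nonneg a])
  have hg1 : ‖g 1‖ ≤ 1 := by simpa only [hg, norm_one, one_mul] using g.le_opNorm 1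
  have hga' : ‖g a‖ ≤ ‖a‖ := by simpa only [hg, one_mul] using g.le_opNorm a
  have hre : 1 + ‖a‖ ≤ (g 1).re + (g a).re := by
    rw [← Complex.add_re, ← map_add, hga]
    exact hnorm
  have hre1 : (g 1).re ≤ ‖g 1‖ := Complex.re_le_norm _
  have hrea : (g a).re ≤ ‖g a‖ := Complex.re_le_norm _
  have hg1_eq : g 1 = 1 := by
    simpa using eq_ofReal_of_norm_le_of_le_re hg1 (by linarith)
  have hga_eq : g a = ‖a‖ := eq_ofReal_of_norm_le_of_le_re hga' (by linarith)
  exact ⟨.mk₀ g.toLinearMap fun _ => apply_nonneg_of_norm_le_one hg.le hg1_eq, hg1_eq, hga_eq⟩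

end PositiveMaps

section PureFunctionals

lemma exists_mem_extremePoints_isMaxOn {E : Type*} [AddCommGroup E] [Module ℝ E]
    [TopologicalSpace E] [T2Space E] [IsTopologicalAddGroup E] [ContinuousSMul ℝ E]
    [LocallyConvexSpace ℝ E] {s : Set E} (hs : IsCompact s) (hne : s.Nonempty)
    (l : StrongDual ℝ E) : ∃ x ∈ s.extremePoints ℝ, IsMaxOn l s x := by
  have hexp : IsExposed ℝ s (l.toExposed s) := ContinuousLinearMap.toExposed.isExposed
  obtain ⟨x₀, hx₀, hmax⟩ := hs.exists_isMaxOn hne l.continuous.continuousOn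
  obtain ⟨x, hx⟩ := (hexp.isCompact hs).extremePoints_nonempty ⟨x₀, hx₀, hmax⟩
  exact ⟨x, hexp.isExtreme.extremePoints_subset_extremePoints hx, hx.1.2⟩

variable {B : Type*} [CStarAlgebra B] [PartialOrder B] [StarOrderedRing B]

/-- A positive functional `f` is pure if every positive functional dominated by `f` is a scalar
multiple of `f`. -/
def IsPureFunctional (f : B →ₚ[ℂ] ℂ) : Prop :=
  ∀ g : B →ₚ[ℂ] ℂ, (∀ b, 0 ≤ b → g b ≤ f b) → ∃ c : ℂ, ∀ b, g b = c * f b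

/-- The states of `B` vanishing on `Z`, as a subset of the function space `B → ℂ`, whose product
topology induces the weak-⋆ topology. -/
def statesVanishingOn (Z : Set B) : Set (B → ℂ) :=
  {F | ∃ f : B →ₚ[ℂ] ℂ, ⇑f = F ∧ f 1 = 1 ∧ ∀ z ∈ Z, f z = 0}

lemma isClosed_statesVanishingOn (Z : Set B) : IsClosed (statesVanishingOn Z) := by
  have heq : statesVanishingOn Z =
      {F | (∀ a b, F (a + b) = F a + F b) ∧ (∀ (c : ℂ) b, F (c • b) = c * F b) ∧
        (∀ b, 0 ≤ F (star b * b)) ∧ F 1 = 1 ∧ ∀ z ∈ Z, F z = 0} := by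
    ext F
    constructor
    · rintro ⟨f, rfl, hf1, hfZ⟩
      exact ⟨map_add f, map_smul f, fun b => f.map_nonneg (star_mul_self_nonneg b), hf1, hfZ⟩
    · rintro ⟨hadd, hsmul, hpos, hF1, hFZ⟩
      exact ⟨positiveOfStarMulSelf ⟨⟨F, hadd⟩, hsmul⟩ hpos, rfl, hF1, hFZ⟩
  rw [heq]
  simp only [Set.ofPred_and, Set.ofPred_forall]
  refine .inter ?_ (.inter ?_ (.inter ?_ (.inter ?_ ?_)))
  · exact isClosed_iInter fun a => isClosed_iInter fun b => isClosed_eq (by fun_prop) (by fun_prop)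
  · exact isClosed_iInter fun c => isClosed_iInter fun b => isClosed_eq (by fun_prop) (by fun_prop)
  · exact isClosed_iInter fun b => isClosed_le continuous_const (by fun_prop)
  · exact isClosed_eq (by fun_prop) continuous_const
  · exact isClosed_biInter fun z _ => isClosed_eq (by fun_prop) continuous_const

lemma isCompact_statesVanishingOn (Z : Set B) : IsCompact (statesVanishingOn Z) := by
  have hpi : IsCompact (Set.univ.pi fun b : B => Metric.closedBall (0 : ℂ) (4 * ‖b‖)) :=
    isCompact_univ_pi fun b => isCompact_closedBall _ _
  refine hpi.of_isClosed_subset (isClosed_statesVanishingOn Z) ?_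
  rintro _ ⟨f, rfl, hf1, -⟩ b -
  rw [mem_closedBall_zero_iff]
  exact norm_map_le_four_mul_norm f (by rw [hf1, norm_one]) b

lemma inv_smul_mem_statesVanishingOn {Z : Set B} {h : B →ₗ[ℂ] ℂ} {t : ℝ} (ht : 0 < t)
    (hpos : ∀ b, 0 ≤ h (star b * b)) (h1 : h 1 = t) (hZ : ∀ z ∈ Z, h z = 0) :
    t⁻¹ • ⇑h ∈ statesVanishingOn Z := by
  refine ⟨positiveOfStarMulSelf (t⁻¹ • h) fun b => smul_nonneg (inv_nonneg.mpr ht.le) (hpos b),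
    rfl, ?_, fun z hz => ?_⟩
  · simp [h1, ht.ne']
  · simp [hZ z hz]

/- If `0 ≤ g ≤ f` and `g 1 = s`, then `f` is the convex combination, with weights `(1 + s) / 3` and
`(2 - s) / 3`, of the states `(f + g) / (1 + s)` and `(2 f - g) / (2 - s)`. Unlike in
`f = g + (f - g)`, neither normalization degenerates for `s ∈ [0, 1]`. -/
lemma isPureFunctional_of_mem_extremePoints {Z : Set B} (hZ : ∀ z ∈ Z, 0 ≤ z) {f : B →ₚ[ℂ] ℂ}
    (hf : ⇑f ∈ (statesVanishingOn Z).extremePoints ℝ) : IsPureFunctional f := by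
  obtain ⟨⟨f', hff', hf1, hfZ⟩, hext⟩ := hf
  obtain rfl : f = f' := (DFunLike.coe_injective hff').symm
  intro g hgf
  have hgpos (b : B) : 0 ≤ g (star b * b) := g.map_nonneg (star_mul_self_nonneg b)
  have hfgpos (b : B) : 0 ≤ f (star b * b) - g (star b * b) :=
    sub_nonneg.mpr (hgf _ (star_mul_self_nonneg b))
  have hfpos (b : B) : 0 ≤ f (star b * b) := f.map_nonneg (star_mul_self_nonneg b)
  have hgZ (z) (hz : z ∈ Z) : g z = 0 :=
    le_antisymm ((hgf z (hZ z hz)).trans (hfZ z hz).le) (g.map_nonneg (hZ z hz))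
  obtain ⟨s, hs⟩ : ∃ s : ℝ, g 1 = s := ⟨_, Complex.eq_re_of_ofReal_le (g.map_nonneg zero_le_one)⟩
  have hs01 : 0 ≤ s ∧ s ≤ 1 := by
    have h01 := And.intro (g.map_nonneg (zero_le_one (α := B))) (hgf 1 zero_le_one)
    rw [hs, hf1] at h01
    exact_mod_cast h01
  have hadd : (1 + s)⁻¹ • ⇑(f.toLinearMap + g.toLinearMap) ∈ statesVanishingOn Z :=
    inv_smul_mem_statesVanishingOn (by linarith) (fun b => add_nonneg (hfpos b) (hgpos b))
      (by simp [hf1, hs]) fun z hz => by simp [hfZ z hz, hgZ z hz]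
  have hsub : (2 - s)⁻¹ • ⇑(f.toLinearMap + (f.toLinearMap - g.toLinearMap)) ∈
      statesVanishingOn Z :=
    inv_smul_mem_statesVanishingOn (by linarith) (fun b => add_nonneg (hfpos b) (hfgpos b))
      (by simp [hf1, hs]; ring) fun z hz => by simp [hfZ z hz, hgZ z hz]
  have h1s : 1 + s ≠ 0 := by linarith
  have h2s : 2 - s ≠ 0 := by linarith
  have heq := hext hadd hsub ⟨(1 + s) / 3, (2 - s) / 3, by linarith, by linarith, by ring, by
    rw [smul_smul, smul_smul, div_mul_eq_mul_div, div_mul_eq_mul_div, mul_inv_cancel₀ h1s,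
      mul_inv_cancel₀ h2s, ← smul_add]
    ext b
    simp only [PositiveLinearMap.coe_toLinearMap, Pi.smul_apply, Pi.add_apply,
      LinearMap.add_apply, LinearMap.sub_apply, Complex.real_smul]
    push_cast
    ring⟩
  refine ⟨s, fun b => ?_⟩
  have hb : f b + g b = (1 + s) • f b := (inv_smul_eq_iff₀ h1s).mp (congrFun heq b)
  rw [add_smul, one_smul] at hb
  exact add_left_cancel hb

theorem exists_isPureFunctional {Z : Set B} (hZ : ∀ z ∈ Z, 0 ≤ z) (b₀ : B) {f₀ : B →ₚ[ℂ] ℂ}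
    (hf₀ : f₀ 1 = 1) (hf₀Z : ∀ z ∈ Z, f₀ z = 0) :
    ∃ f : B →ₚ[ℂ] ℂ, IsPureFunctional f ∧ f 1 = 1 ∧ (∀ z ∈ Z, f z = 0) ∧
      (f₀ b₀).re ≤ (f b₀).re := by
  obtain ⟨F, hF, hmax⟩ := exists_mem_extremePoints_isMaxOn (isCompact_statesVanishingOn Z)
    ⟨f₀, f₀, rfl, hf₀, hf₀Z⟩ (Complex.reCLM ∘L ContinuousLinearMap.proj (R := ℝ) b₀)
  obtain ⟨f, rfl, hf1, hfZ⟩ := hF.1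
  exact ⟨f, isPureFunctional_of_mem_extremePoints hZ hF, hf1, hfZ, hmax ⟨f₀, rfl, hf₀, hf₀Z⟩⟩

end PureFunctionals

section Irreducible

open scoped InnerProductSpace

lemma four_smul_eq_sum_star_mul_self {R : Type*} [Ring R] [StarRing R] [Algebra ℂ R]
    [StarModule ℂ R] (a : R) :
    (4 : ℂ) • a = ∑ k ∈ Finset.range 4, Complex.I ^ k •
      (star (a + Complex.I ^ k • 1) * (a + Complex.I ^ k • 1)) := by
  simp only [Finset.sum_range_succ, Finset.sum_range_zero, zero_add, star_add, star_smul, star_one,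
    star_pow, add_mul, mul_add, smul_mul_assoc, mul_smul_comm, one_mul, mul_one, smul_add,
    smul_smul, Complex.star_def, Complex.conj_I, pow_succ, pow_zero, neg_mul, mul_neg,
    Complex.I_mul_I, neg_neg]
  module

variable {B : Type*} [CStarAlgebra B]
  {H : Type*} [NormedAddCommGroup H] [InnerProductSpace ℂ H] [CompleteSpace H]

/-- A representation is irreducible if its commutant is trivial. -/
def IsIrreducibleRep (π : B →⋆ₐ[ℂ] (H →L[ℂ] H)) : Prop :=
  ∀ T : H →L[ℂ] H, (∀ b, Commute T (π b)) → ∃ c : ℂ, T = c • 1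

lemma inner_rep_apply_left (π : B →⋆ₐ[ℂ] (H →L[ℂ] H)) (b : B) (x y : H) :
    ⟪π b x, y⟫_ℂ = ⟪x, π (star b) y⟫_ℂ := by
  rw [map_star, ContinuousLinearMap.star_eq_adjoint, ContinuousLinearMap.adjoint_inner_right]

lemma inner_rep_star_mul_self (π : B →⋆ₐ[ℂ] (H →L[ℂ] H)) (b : B) (x : H) :
    ⟪x, π (star b * b) x⟫_ℂ = ((‖π b x‖ ^ 2 : ℝ) : ℂ) := by
  rw [map_mul, mul_apply_eq_comp, ← inner_rep_apply_left, inner_self_eq_norm_sq_to_K]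
  norm_cast

lemma eq_smul_one_of_apply_cyclic {π : B →⋆ₐ[ℂ] (H →L[ℂ] H)} {ξ : H}
    (hξ : DenseRange fun b => π b ξ) {T : H →L[ℂ] H} (hT : ∀ b, Commute T (π b)) {c : ℂ}
    (hc : T ξ = c • ξ) : T = c • 1 := by
  refine DFunLike.coe_injective (hξ.equalizer T.continuous (c • 1 : H →L[ℂ] H).continuous ?_)
  funext b
  calc T (π b ξ) = π b (T ξ) := DFunLike.congr_fun (hT b) ξ
    _ = c • π b ξ := by rw [hc, map_smul]

variable [PartialOrder B] [StarOrderedRing B]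

/-- The positive functional `b ↦ ⟪ξ, π b ξ⟫` defined by a vector of a representation. -/
noncomputable def vectorFunctional (π : B →⋆ₐ[ℂ] (H →L[ℂ] H)) (ξ : H) : B →ₚ[ℂ] ℂ :=
  positiveOfStarMulSelf
    { toFun b := ⟪ξ, π b ξ⟫_ℂ
      map_add' a b := by simp only [map_add, add_apply, inner_add_right]
      map_smul' c b := by simp only [map_smul, smul_apply, inner_smul_right, RingHom.id_apply,
        smul_eq_mul] }
    fun b => by
      change 0 ≤ ⟪ξ, π (star b * b) ξ⟫_ℂ
      rw [inner_rep_star_mul_self]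
      exact Complex.zero_le_real.mpr (sq_nonneg _)

lemma vectorFunctional_apply (π : B →⋆ₐ[ℂ] (H →L[ℂ] H)) (ξ : H) (b : B) :
    vectorFunctional π ξ b = ⟪ξ, π b ξ⟫_ℂ := rfl

lemma vectorFunctional_star_mul_self (π : B →⋆ₐ[ℂ] (H →L[ℂ] H)) (ξ : H) (b : B) :
    vectorFunctional π ξ (star b * b) = ((‖π b ξ‖ ^ 2 : ℝ) : ℂ) :=
  inner_rep_star_mul_self π b ξ

variable {π : B →⋆ₐ[ℂ] (H →L[ℂ] H)} {ξ : H}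

lemma exists_star_mul_self_eq_smul_one_of_norm_le_one
    (hpure : IsPureFunctional (vectorFunctional π ξ)) (hξ : DenseRange fun b => π b ξ)
    {S : H →L[ℂ] H} (hS : ∀ b, Commute S (π b)) (hS1 : ‖S‖ ≤ 1) :
    ∃ c : ℂ, star S * S = c • 1 := by
  have hSπ (b : B) (x : H) : S (π b x) = π b (S x) := DFunLike.congr_fun (hS b) x
  have hle (a : B) (ha : 0 ≤ a) : vectorFunctional π (S ξ) a ≤ vectorFunctional π ξ a := by
    obtain ⟨b, rfl⟩ := CStarAlgebra.nonneg_iff_eq_star_mul_self.mp ha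
    rw [vectorFunctional_star_mul_self, vectorFunctional_star_mul_self, ← hSπ]
    norm_cast
    gcongr
    exact (S.le_of_opNorm_le hS1 _).trans_eq (one_mul _)
  obtain ⟨c, hc⟩ := hpure _ hle
  have hstarS (b : B) : Commute (star S) (π b) := by
    simpa only [map_star, star_star] using (hS (star b)).star_star
  refine ⟨star c, eq_smul_one_of_apply_cyclic hξ (fun b => (hstarS b).mul_left (hS b)) ?_⟩
  refine hξ.eq_of_inner_left ℂ fun b => ?_
  calc ⟪(star S * S) ξ, π b ξ⟫_ℂ = ⟪S ξ, π b (S ξ)⟫_ℂ := by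
        rw [mul_apply_eq_comp, ContinuousLinearMap.star_eq_adjoint,
          ContinuousLinearMap.adjoint_inner_left, hSπ]
    _ = c * ⟪ξ, π b ξ⟫_ℂ := hc b
    _ = ⟪star c • ξ, π b ξ⟫_ℂ := by rw [inner_smul_left, starRingEnd_apply, star_star]

lemma exists_star_mul_self_eq_smul_one
    (hpure : IsPureFunctional (vectorFunctional π ξ)) (hξ : DenseRange fun b => π b ξ)
    {S : H →L[ℂ] H} (hS : ∀ b, Commute S (π b)) : ∃ c : ℂ, star S * S = c • 1 := by
  have hpos : 0 < ‖S‖ + 1 := by positivity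
  set r : ℂ := ((‖S‖ + 1 : ℝ) : ℂ) with hr
  have hr0 : r ≠ 0 := Complex.ofReal_ne_zero.mpr hpos.ne'
  obtain ⟨c, hc⟩ := exists_star_mul_self_eq_smul_one_of_norm_le_one hpure hξ
    (S := r⁻¹ • S) (fun b => (hS b).smul_left _) (by
      rw [norm_smul, norm_inv, hr, Complex.norm_of_nonneg hpos.le, inv_mul_le_one₀ hpos]
      linarith)
  refine ⟨star r * r * c, ?_⟩
  have hS' : S = r • r⁻¹ • S := (smul_inv_smul₀ hr0 S).symm
  rw [hS', star_smul, smul_mul_smul_comm, hc, smul_smul]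

/- By polarization, a star algebra of operators is spanned by its elements `S⋆ S`, and purity makes
those of the commutant scalar. -/
theorem isIrreducibleRep_of_isPureFunctional
    (hpure : IsPureFunctional (vectorFunctional π ξ)) (hξ : DenseRange fun b => π b ξ) :
    IsIrreducibleRep π := by
  intro T hT
  have hsq (u : ℂ) : ∃ c : ℂ, star (T + u • 1) * (T + u • 1) = c • 1 :=
    exists_star_mul_self_eq_smul_one hpure hξ fun b =>
      (hT b).add_left ((Commute.one_left _).smul_left u)
  choose c hc using hsq
  refine ⟨(4 : ℂ)⁻¹ * ∑ k ∈ Finset.range 4, Complex.I ^ k * c (Complex.I ^ k), ?_⟩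
  rw [← inv_smul_smul₀ (four_ne_zero' ℂ) T, four_smul_eq_sum_star_mul_self T]
  simp only [hc, smul_smul, ← Finset.sum_smul]

end Irreducible

section GNSVector

open UniformSpace

variable {B : Type*} [CStarAlgebra B] [PartialOrder B] [StarOrderedRing B] (f : B →ₚ[ℂ] ℂ)

/-- The cyclic vector of the GNS representation of `f`, the class of `1`. -/
noncomputable def gnsVector : f.GNS := (f.toPreGNS 1 : Completion f.PreGNS)

lemma gnsStarAlgHom_gnsVector (b : B) :
    f.gnsStarAlgHom b (gnsVector f) = (f.toPreGNS b : Completion f.PreGNS) := by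
  change f.gnsNonUnitalStarAlgHom b (f.toPreGNS 1 : Completion f.PreGNS) = _
  rw [PositiveLinearMap.gnsNonUnitalStarAlgHom_apply_coe]
  simp

lemma denseRange_gnsStarAlgHom_gnsVector :
    DenseRange fun b => f.gnsStarAlgHom b (gnsVector f) := by
  simp only [gnsStarAlgHom_gnsVector]
  exact Completion.denseRange_coe.comp f.toPreGNS.surjective.denseRange
    (Completion.continuous_coe _)

lemma vectorFunctional_gnsStarAlgHom_gnsVector :
    vectorFunctional f.gnsStarAlgHom (gnsVector f) = f := by
  ext b
  rw [vectorFunctional_apply, gnsStarAlgHom_gnsVector, gnsVector, Completion.inner_coe,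
    f.preGNS_inner_def]
  simp

lemma isIrreducibleRep_gnsStarAlgHom {f : B →ₚ[ℂ] ℂ} (hf : IsPureFunctional f) :
    IsIrreducibleRep f.gnsStarAlgHom :=
  isIrreducibleRep_of_isPureFunctional
    (by rwa [vectorFunctional_gnsStarAlgHom_gnsVector]) (denseRange_gnsStarAlgHom_gnsVector f)

end GNSVector

section Intertwiners

variable {B : Type*} [CStarAlgebra B]
  {H₁ : Type*} [NormedAddCommGroup H₁] [InnerProductSpace ℂ H₁] [CompleteSpace H₁]
  {H₂ : Type*} [NormedAddCommGroup H₂] [InnerProductSpace ℂ H₂] [CompleteSpace H₂]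
  {H₃ : Type*} [NormedAddCommGroup H₃] [InnerProductSpace ℂ H₃] [CompleteSpace H₃]

/-- The space of bounded operators intertwining two representations. In particular
`intertwiners π π` is the commutant of `π`. -/
def intertwiners (π : B →⋆ₐ[ℂ] (H₁ →L[ℂ] H₁)) (ρ : B →⋆ₐ[ℂ] (H₂ →L[ℂ] H₂)) :
    Submodule ℂ (H₁ →L[ℂ] H₂) where
  carrier := {T | ∀ b x, T (π b x) = ρ b (T x)}
  add_mem' hS hT b x := by simp only [add_apply, map_add, hS b x, hT b x]
  zero_mem' b x := by simp only [zero_apply, map_zero]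
  smul_mem' c T hT b x := by simp only [smul_apply, map_smul, hT b x]

variable {π : B →⋆ₐ[ℂ] (H₁ →L[ℂ] H₁)} {ρ : B →⋆ₐ[ℂ] (H₂ →L[ℂ] H₂)}
  {σ : B →⋆ₐ[ℂ] (H₃ →L[ℂ] H₃)}

lemma mem_intertwiners_self_iff {T : H₁ →L[ℂ] H₁} :
    T ∈ intertwiners π π ↔ ∀ b, Commute T (π b) :=
  ⟨fun hT b => ContinuousLinearMap.ext (hT b), fun hT b => DFunLike.congr_fun (hT b)⟩

lemma one_mem_intertwiners : 1 ∈ intertwiners π π := fun _ _ => rfl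

lemma comp_mem_intertwiners {S : H₂ →L[ℂ] H₃} {T : H₁ →L[ℂ] H₂} (hS : S ∈ intertwiners ρ σ)
    (hT : T ∈ intertwiners π ρ) : S ∘L T ∈ intertwiners π σ := fun b x => by
  rw [ContinuousLinearMap.comp_apply, hT, hS, ContinuousLinearMap.comp_apply]

lemma adjoint_mem_intertwiners {T : H₁ →L[ℂ] H₂} (hT : T ∈ intertwiners π ρ) :
    T.adjoint ∈ intertwiners ρ π := by
  intro b x
  refine ext_inner_left ℂ fun y => ?_
  rw [ContinuousLinearMap.adjoint_inner_right, ← star_star b, ← inner_rep_apply_left,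
    ← inner_rep_apply_left, ContinuousLinearMap.adjoint_inner_right, hT]

/- Schur's lemma: if `T ≠ 0` intertwines, then `T T⋆` is a nonzero scalar `c`, and `T⋆ S` is a
scalar `e` for every other intertwiner `S`, so `c S = e T`. -/
theorem finiteDimensional_intertwiners (hπ : IsIrreducibleRep π) (hρ : IsIrreducibleRep ρ) :
    FiniteDimensional ℂ (intertwiners π ρ) := by
  by_cases hbot : intertwiners π ρ = ⊥
  · rw [hbot]; infer_instance
  obtain ⟨T, hT, hT0⟩ := Submodule.exists_mem_ne_zero_of_ne_bot hbot
  have hTadj := adjoint_mem_intertwiners hT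
  obtain ⟨c, hc⟩ := hρ _ (mem_intertwiners_self_iff.mp (comp_mem_intertwiners hT hTadj))
  have hc0 : c ≠ 0 := by
    rintro rfl
    have hnorm := T.adjoint.norm_adjoint_comp_self
    rw [ContinuousLinearMap.adjoint_adjoint, hc, zero_smul, norm_zero, eq_comm, mul_self_eq_zero,
      LinearIsometryEquiv.norm_map, norm_eq_zero] at hnorm
    exact hT0 hnorm
  refine Submodule.finiteDimensional_of_le (S₂ := Submodule.span ℂ {T}) fun S hS => ?_
  obtain ⟨e, he⟩ := hπ _ (mem_intertwiners_self_iff.mp (comp_mem_intertwiners hTadj hS))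
  have hcS : c • S = e • T := calc
    c • S = (T ∘L T.adjoint) ∘L S := by rw [hc]; rfl
    _ = T ∘L (T.adjoint ∘L S) := rfl
    _ = e • T := by rw [he]; ext x; exact map_smul T e x
  refine Submodule.mem_span_singleton.mpr ⟨c⁻¹ * e, ?_⟩
  rw [mul_smul, ← hcS, inv_smul_smul₀ hc0]

/-- The subspace spanned by the translates of `W` under the commutant of `π`, the smallest
subspace containing `W` that can be the range of a projection in the double commutant. -/
def commutantSpan (π : B →⋆ₐ[ℂ] (H₁ →L[ℂ] H₁)) (W : Submodule ℂ H₁) : Submodule ℂ H₁ :=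
  Submodule.map₂ (ContinuousLinearMap.coeLM ℂ) (intertwiners π π) W

variable {W : Submodule ℂ H₁}

lemma apply_mem_commutantSpan {T : H₁ →L[ℂ] H₁} (hT : T ∈ intertwiners π π) {w : H₁}
    (hw : w ∈ W) : T w ∈ commutantSpan π W :=
  Submodule.apply_mem_map₂ (ContinuousLinearMap.coeLM ℂ) hT hw

lemma le_commutantSpan : W ≤ commutantSpan π W := fun _ =>
  apply_mem_commutantSpan one_mem_intertwiners

lemma commutantSpan_le_comap {S : H₁ →L[ℂ] H₁}
    (hS : ∀ T ∈ intertwiners π π, ∀ w ∈ W, S (T w) ∈ commutantSpan π W) :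
    commutantSpan π W ≤ (commutantSpan π W).comap S.toLinearMap :=
  Submodule.map₂_le.mpr hS

lemma apply_mem_commutantSpan_of_mem_intertwiners {S : H₁ →L[ℂ] H₁} (hS : S ∈ intertwiners π π)
    {x : H₁} (hx : x ∈ commutantSpan π W) : S x ∈ commutantSpan π W :=
  commutantSpan_le_comap
    (fun _ hT _ hw => apply_mem_commutantSpan (comp_mem_intertwiners hS hT) hw) hx

lemma apply_mem_commutantSpan_of_mapsTo {b : B} (hb : ∀ w ∈ W, π b w ∈ W) {x : H₁}
    (hx : x ∈ commutantSpan π W) : π b x ∈ commutantSpan π W :=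
  commutantSpan_le_comap
    (fun _ hT w hw => hT b w ▸ apply_mem_commutantSpan hT (hb w hw)) hx

instance finiteDimensional_commutantSpan [FiniteDimensional ℂ (intertwiners π π)]
    [FiniteDimensional ℂ W] : FiniteDimensional ℂ (commutantSpan π W) :=
  Module.Finite.iff_fg.mpr <|
    .map₂ _ (Module.Finite.iff_fg.mp inferInstance) (Module.Finite.iff_fg.mp inferInstance)

lemma commute_starProjection (V : Submodule ℂ H₁) [V.HasOrthogonalProjection] {T : H₁ →L[ℂ] H₁}
    (hT : ∀ x ∈ V, T x ∈ V) (hTadj : ∀ x ∈ V, T.adjoint x ∈ V) : Commute V.starProjection T := by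
  ext x
  refine V.eq_starProjection_of_mem_of_inner_eq_zero
    (hT _ (V.starProjection_apply_mem x)) fun w hw => ?_
  change inner ℂ (T x - T (V.starProjection x)) w = 0
  rw [← map_sub, ← ContinuousLinearMap.adjoint_inner_right]
  exact V.starProjection_inner_eq_zero x _ (hTadj w hw)

theorem exists_isStarProjection_of_finiteDimensional_commutant
    [FiniteDimensional ℂ (intertwiners π π)] (D : StarSubalgebra ℂ B) [FiniteDimensional ℂ W]
    (hW : ∀ d ∈ D, ∀ w ∈ W, π d w ∈ W) :
    ∃ P : H₁ →L[ℂ] H₁, IsStarProjection P ∧ FiniteDimensional ℂ P.range ∧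
      P ∈ Set.centralizer (Set.centralizer (Set.range π)) ∧
      (∀ d ∈ D, Commute P (π d)) ∧ ∀ w ∈ W, P w = w := by
  set V := commutantSpan π W
  refine ⟨V.starProjection, isStarProjection_starProjection, ?_, fun S hS => ?_, fun d hd => ?_,
    fun w hw => Submodule.starProjection_eq_self_iff.mpr (le_commutantSpan hw)⟩
  · rw [Submodule.range_starProjection]
    infer_instance
  · have hSπ : S ∈ intertwiners π π := mem_intertwiners_self_iff.mpr fun b => (hS _ ⟨b, rfl⟩).symm
    exact (commute_starProjection V
      (fun _ => apply_mem_commutantSpan_of_mem_intertwiners hSπ)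
      (fun _ => apply_mem_commutantSpan_of_mem_intertwiners (adjoint_mem_intertwiners hSπ))).symm
  · refine commute_starProjection V (fun _ => apply_mem_commutantSpan_of_mapsTo (hW d hd)) ?_
    rw [← ContinuousLinearMap.star_eq_adjoint, ← map_star]
    exact fun _ => apply_mem_commutantSpan_of_mapsTo (hW _ (star_mem hd))

end Intertwiners

section DirectSum

open scoped InnerProductSpace

variable {B : Type*} [CStarAlgebra B] {ι : Type*} [Fintype ι] {H : ι → Type*}
  [∀ i, NormedAddCommGroup (H i)] [∀ i, InnerProductSpace ℂ (H i)] [∀ i, CompleteSpace (H i)]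
  (π : ∀ i, B →⋆ₐ[ℂ] (H i →L[ℂ] H i))

/-- The direct sum of a finite family of representations. -/
noncomputable def directSumRep : B →⋆ₐ[ℂ] (PiLp 2 H →L[ℂ] PiLp 2 H) where
  toFun b := (PiLp.continuousLinearEquiv 2 ℂ H).symm.toContinuousLinearMap ∘L
    ContinuousLinearMap.pi fun i => π i b ∘L PiLp.proj 2 H i
  map_one' := by ext; simp
  map_mul' a b := by ext; simp
  map_zero' := by ext; simp
  map_add' a b := by ext; simp
  commutes' c := by ext; simp [Algebra.algebraMap_eq_smul_one]
  map_star' b := by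
    rw [ContinuousLinearMap.star_eq_adjoint, ContinuousLinearMap.eq_adjoint_iff]
    intro x y
    simp only [PiLp.inner_apply]
    refine Finset.sum_congr rfl fun i _ => ?_
    simpa using inner_rep_apply_left (π i) (star b) (x i) (y i)

@[simp]
lemma directSumRep_apply (b : B) (x : PiLp 2 H) (i : ι) :
    directSumRep π b x i = π i b (x i) := rfl

lemma directSumRep_single [DecidableEq ι] (b : B) (i : ι) (x : H i) :
    directSumRep π b (PiLp.single 2 i x) = PiLp.single 2 i (π i b x) := by
  ext j
  rcases eq_or_ne j i with rfl | hji
  · simp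
  · simp [hji]

lemma vectorFunctional_directSumRep_single [DecidableEq ι] [PartialOrder B] [StarOrderedRing B]
    (i : ι) (x : H i) :
    vectorFunctional (directSumRep π) (PiLp.single 2 i x) = vectorFunctional (π i) x := by
  ext b
  rw [vectorFunctional_apply, vectorFunctional_apply, directSumRep_single, PiLp.inner_apply,
    Finset.sum_eq_single i (fun j _ hji => by simp [hji]) (by simp)]
  simp

variable {π} in
lemma finiteDimensional_intertwiners_directSumRep (hπ : ∀ i, IsIrreducibleRep (π i)) :
    FiniteDimensional ℂ (intertwiners (directSumRep π) (directSumRep π)) := by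
  classical
  have := fun i j => finiteDimensional_intertwiners (hπ i) (hπ j)
  let inclusion (j) : H j →L[ℂ] PiLp 2 H :=
    (PiLp.continuousLinearEquiv 2 ℂ H).symm.toContinuousLinearMap ∘L
      ContinuousLinearMap.single ℂ H j
  have inclusion_mem (j) : inclusion j ∈ intertwiners (π j) (directSumRep π) := fun b x =>
    (directSumRep_single π b j x).symm
  have proj_mem (j) : PiLp.proj 2 H j ∈ intertwiners (directSumRep π) (π j) := fun b x => rfl
  let matrixEntries : intertwiners (directSumRep π) (directSumRep π) →ₗ[ℂ]
      (∀ p : ι × ι, intertwiners (π p.1) (π p.2)) :=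
    { toFun T p := ⟨PiLp.proj 2 H p.2 ∘L T.1 ∘L inclusion p.1, comp_mem_intertwiners
        (proj_mem p.2) (comp_mem_intertwiners T.2 (inclusion_mem p.1))⟩
      map_add' S T := by ext; simp
      map_smul' c T := by ext; simp }
  refine .of_injective matrixEntries ((injective_iff_map_eq_zero _).mpr fun T hT => ?_)
  have hTsingle (j) (x : H j) : T.1 (PiLp.single 2 j x) = 0 := by
    ext i
    exact DFunLike.congr_fun (congrArg Subtype.val (congrFun hT (j, i))) x
  ext1
  ext1 x
  have hx : x = ∑ j, PiLp.single 2 j (x j) := by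
    ext i
    simp [WithLp.ofLp_sum, Finset.sum_apply, Finset.sum_pi_single]
  rw [hx, map_sum]
  simp [hTsingle]

theorem exists_rep_of_isPureFunctional {B : Type u} [CStarAlgebra B] [PartialOrder B]
    [StarOrderedRing B] {ι : Type} [Finite ι] {f : ι → B →ₚ[ℂ] ℂ}
    (hf : ∀ i, IsPureFunctional (f i)) :
    ∃ (H : Type u) (_ : NormedAddCommGroup H) (_ : InnerProductSpace ℂ H) (_ : CompleteSpace H)
      (ρ : B →⋆ₐ[ℂ] (H →L[ℂ] H)) (η : ι → H), FiniteDimensional ℂ (intertwiners ρ ρ) ∧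
      ∀ i, vectorFunctional ρ (η i) = f i := by
  classical
  have := Fintype.ofFinite ι
  refine ⟨PiLp 2 fun i => (f i).GNS, inferInstance, inferInstance, inferInstance,
    directSumRep fun i => (f i).gnsStarAlgHom, fun i => PiLp.single 2 i (gnsVector (f i)),
    finiteDimensional_intertwiners_directSumRep fun i => isIrreducibleRep_gnsStarAlgHom (hf i),
    fun i => ?_⟩
  rw [vectorFunctional_directSumRep_single, vectorFunctional_gnsStarAlgHom_gnsVector]

end DirectSum

section Criterion

lemma finiteDimensional_map_of_ker_le {𝕜 V K H : Type*} [Field 𝕜] [AddCommGroup V] [Module 𝕜 V]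
    [AddCommGroup K] [Module 𝕜 K] [FiniteDimensional 𝕜 K] [AddCommGroup H] [Module 𝕜 H]
    {D : Submodule 𝕜 V} {Ψ : V →ₗ[𝕜] K} {L : V →ₗ[𝕜] H}
    (h : ∀ d ∈ D, Ψ d = 0 → L d = 0) : FiniteDimensional 𝕜 (D.map L) := by
  have hker : LinearMap.ker (Ψ.domRestrict D) ≤ LinearMap.ker (L.domRestrict D) :=
    fun d => h d d.2
  have : FiniteDimensional 𝕜 (D ⧸ LinearMap.ker (Ψ.domRestrict D)) :=
    (Ψ.domRestrict D).quotKerEquivRange.symm.finiteDimensional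
  rw [← LinearMap.range_domRestrict, ← Submodule.range_liftQ _ _ hker]
  infer_instance

variable {B : Type u} [CStarAlgebra B]

section NormingState

variable [PartialOrder B] [StarOrderedRing B]

lemma exists_isPureFunctional_of_multiplicativeOn {C : Type*} [CStarAlgebra C] [PartialOrder C]
    [StarOrderedRing C] {Ψ : B →ₚ[ℂ] C} (hΨ : Ψ 1 = 1) {D : StarSubalgebra ℂ B}
    (hD : ∀ d ∈ D, ∀ e ∈ D, Ψ (d * e) = Ψ d * Ψ e) {d₀ : B} (hd₀ : d₀ ∈ D) (hΨd₀ : Ψ d₀ ≠ 0) :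
    ∃ f : B →ₚ[ℂ] ℂ, IsPureFunctional f ∧ f 1 = 1 ∧
      (∀ d ∈ D, Ψ d = 0 → f (star d * d) = 0) ∧ ‖Ψ d₀‖ ^ 2 ≤ (f (star d₀ * d₀)).re := by
  have hsq (d) (hd : d ∈ D) : Ψ (star d * d) = star (Ψ d) * Ψ d := by
    rw [hD _ (star_mem hd) _ hd, map_star]
  have : Nontrivial C := nontrivial_of_ne _ _ hΨd₀
  obtain ⟨g, hg_one, hg_norm⟩ := exists_state_apply_eq_norm (star_mul_self_nonneg (Ψ d₀))
  obtain ⟨f, hf, hf_one, hfZ, hfd₀⟩ := exists_isPureFunctional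
    (Z := (fun d => star d * d) '' {d ∈ D | Ψ d = 0})
    (f₀ := positiveOfStarMulSelf (g.toLinearMap ∘ₗ Ψ.toLinearMap) fun b =>
      g.map_nonneg (Ψ.map_nonneg (star_mul_self_nonneg b)))
    (Set.forall_mem_image.mpr fun d _ => star_mul_self_nonneg d) (star d₀ * d₀)
    (by simp [hΨ, hg_one])
    (Set.forall_mem_image.mpr fun d hd => by simp [hsq d hd.1, hd.2])
  refine ⟨f, hf, hf_one, fun d hd hΨd => hfZ _ ⟨d, ⟨hd, hΨd⟩, rfl⟩, ?_⟩
  simpa [hsq d₀ hd₀, hg_norm, CStarRing.norm_star_mul_self, sq] using hfd₀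

end NormingState

section OrbitSubspace

variable {H : Type*} [NormedAddCommGroup H] [InnerProductSpace ℂ H] [CompleteSpace H]

/-- The subspace `π(D) ξ` swept out by a ⋆-subalgebra `D` acting on a vector `ξ`. -/
noncomputable def orbitSubspace (π : B →⋆ₐ[ℂ] (H →L[ℂ] H)) (D : StarSubalgebra ℂ B) (ξ : H) :
    Submodule ℂ H :=
  (Subalgebra.toSubmodule D.toSubalgebra).map
    ((ContinuousLinearMap.apply ℂ H ξ).toLinearMap ∘ₗ π.toAlgHom.toLinearMap)

variable {π : B →⋆ₐ[ℂ] (H →L[ℂ] H)} {D : StarSubalgebra ℂ B} {ξ : H}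

lemma self_mem_orbitSubspace : ξ ∈ orbitSubspace π D ξ := ⟨1, one_mem D, by simp⟩

lemma apply_mem_orbitSubspace {d : B} (hd : d ∈ D) {w : H} (hw : w ∈ orbitSubspace π D ξ) :
    π d w ∈ orbitSubspace π D ξ := by
  obtain ⟨e, he, rfl⟩ := hw
  exact ⟨d * e, D.mul_mem hd he, by simp⟩

lemma finiteDimensional_orbitSubspace [PartialOrder B] [StarOrderedRing B] {K : Type*}
    [AddCommGroup K] [Module ℂ K] [FiniteDimensional ℂ K] {Ψ : B →ₗ[ℂ] K}
    (h : ∀ d ∈ D, Ψ d = 0 → vectorFunctional π ξ (star d * d) = 0) :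
    FiniteDimensional ℂ (orbitSubspace π D ξ) := by
  refine finiteDimensional_map_of_ker_le (Ψ := Ψ) fun d hd hΨd => ?_
  have hd_norm := h d hd hΨd
  rw [vectorFunctional_star_mul_self] at hd_norm
  exact norm_eq_zero.mp (sq_eq_zero_iff.mp (Complex.ofReal_eq_zero.mp hd_norm))

end OrbitSubspace

section Compression

variable {C : Type*} [CStarAlgebra C] [PartialOrder C] [StarOrderedRing C] [FiniteDimensional ℂ C]

lemma norm_apply_le_norm_compression {E : Type*} [NormedAddCommGroup E] [NormedSpace ℂ E]
    {P T : E →L[ℂ] E} {ξ : E} (hξ : ‖ξ‖ ≤ 1) (hPξ : P ξ = ξ) (hPTξ : P (T ξ) = T ξ) :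
    ‖T ξ‖ ≤ ‖P * T * P‖ := calc
  ‖T ξ‖ = ‖(P * T * P) ξ‖ := by rw [mul_apply_eq_comp, mul_apply_eq_comp, hPξ, hPTξ]
  _ ≤ ‖P * T * P‖ := (P * T * P).unit_le_opNorm ξ hξ

theorem exists_rep_norm_le_norm_compression [PartialOrder B] [StarOrderedRing B] {Ψ : B →ₚ[ℂ] C}
    (hΨ : Ψ 1 = 1) {D : StarSubalgebra ℂ B} (hD : ∀ d ∈ D, ∀ e ∈ D, Ψ (d * e) = Ψ d * Ψ e)
    {ι : Type} [Finite ι] {d : ι → B} (hd : ∀ i, d i ∈ D) :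
    ∃ (H : Type u) (_ : NormedAddCommGroup H) (_ : InnerProductSpace ℂ H) (_ : CompleteSpace H)
      (ρ : B →⋆ₐ[ℂ] (H →L[ℂ] H)) (P : H →L[ℂ] H), IsStarProjection P ∧
      FiniteDimensional ℂ P.range ∧ P ∈ Set.centralizer (Set.centralizer (Set.range ρ)) ∧
      (∀ e ∈ D, Commute P (ρ e)) ∧ ∀ i, ‖Ψ (d i)‖ ≤ ‖P * ρ (d i) * P‖ := by
  choose f hf_pure hf_one hf_ker hf_norm using fun i : {i // Ψ (d i) ≠ 0} =>
    exists_isPureFunctional_of_multiplicativeOn hΨ hD (hd i) i.2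
  obtain ⟨H, _, _, _, ρ, η, _, hρ⟩ := exists_rep_of_isPureFunctional hf_pure
  have hnorm (i b) : (f i (star b * b)).re = ‖ρ b (η i)‖ ^ 2 := by
    rw [← hρ i, vectorFunctional_star_mul_self, Complex.ofReal_re]
  have hfinite (i) : FiniteDimensional ℂ (orbitSubspace ρ D (η i)) :=
    finiteDimensional_orbitSubspace (Ψ := Ψ.toLinearMap) (by simpa [hρ i] using hf_ker i)
  let W : Submodule ℂ H := ⨆ i, orbitSubspace ρ D (η i)
  have hW (i) : orbitSubspace ρ D (η i) ≤ W := le_iSup (fun i => orbitSubspace ρ D (η i)) i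
  have hDW (e) (he : e ∈ D) : W ≤ W.comap (ρ e).toLinearMap :=
    iSup_le fun i _ hw => hW i (apply_mem_orbitSubspace he hw)
  obtain ⟨P, hP, hP_finite, hP_mem, hP_comm, hP_fix⟩ :=
    exists_isStarProjection_of_finiteDimensional_commutant D (W := W) fun e he w hw => hDW e he hw
  refine ⟨H, _, _, _, ρ, P, hP, hP_finite, hP_mem, hP_comm, fun i => ?_⟩
  by_cases hi : Ψ (d i) = 0
  · simp [hi]
  have hη : ‖η ⟨i, hi⟩‖ ^ 2 = 1 := by
    simpa [hf_one] using (hnorm ⟨i, hi⟩ 1).symm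
  calc ‖Ψ (d i)‖ ≤ ‖ρ (d i) (η ⟨i, hi⟩)‖ :=
        le_of_sq_le_sq ((hf_norm ⟨i, hi⟩).trans_eq (hnorm _ _)) (norm_nonneg _)
    _ ≤ ‖P * ρ (d i) * P‖ := norm_apply_le_norm_compression
        (pow_le_one_iff_of_nonneg (norm_nonneg _) two_ne_zero |>.mp hη.le)
        (hP_fix _ (hW _ self_mem_orbitSubspace))
        (hP_fix _ (hW _ (apply_mem_orbitSubspace (hd i) self_mem_orbitSubspace)))

lemma norm_commutator_le_of_commute {R : Type*} [NormedRing R] {p a b : R} (hp : ‖p‖ ≤ 1)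
    (hb : Commute p b) : ‖p * a - a * p‖ ≤ 2 * ‖a - b‖ := by
  calc ‖p * a - a * p‖ = ‖p * (a - b) - (a - b) * p‖ := by
        rw [mul_sub, sub_mul, hb.eq, sub_sub_sub_cancel_right]
    _ ≤ 1 * ‖a - b‖ + ‖a - b‖ * 1 :=
        norm_sub_le_of_le (norm_mul_le_of_le hp le_rfl) (norm_mul_le_of_le le_rfl hp)
    _ = 2 * ‖a - b‖ := by ring

lemma norm_compression_le_add {R : Type*} [NormedRing R] {p : R} (hp : ‖p‖ ≤ 1) (a b : R) :
    ‖p * b * p‖ ≤ ‖p * a * p‖ + ‖a - b‖ := by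
  calc ‖p * b * p‖ = ‖p * a * p - p * (a - b) * p‖ := by
        rw [mul_sub, sub_mul, sub_sub_cancel]
    _ ≤ ‖p * a * p‖ + 1 * ‖a - b‖ * 1 :=
        norm_sub_le_of_le le_rfl (norm_mul_le_of_le (norm_mul_le_of_le hp le_rfl) hp)
    _ = ‖p * a * p‖ + ‖a - b‖ := by ring

end Compression

/- A state of a finite-dimensional `C` that norms `Ψ d` pulls back along `Ψ` to a state that does
not see `D ∩ ker Ψ`; replacing it by a pure state with the same property gives an irreducible
representation in which `D` moves the cyclic vector inside a finite-dimensional subspace. -/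
theorem innerQuasidiagonal_of_exists_positive
    (h : ∀ (n : ℕ) (x : Fin n → B) (ε : ℝ), 0 < ε →
      ∃ (C : Type v) (_ : CStarAlgebra C) (_ : PartialOrder C) (_ : StarOrderedRing C)
        (_ : FiniteDimensional ℂ C) (Ψ : B →ₗ[ℂ] C) (D : StarSubalgebra ℂ B),
        (∀ b, 0 ≤ Ψ (star b * b)) ∧ Ψ 1 = 1 ∧ (∀ d ∈ D, ∀ e ∈ D, Ψ (d * e) = Ψ d * Ψ e) ∧
        ∀ i, (∃ d ∈ D, ‖x i - d‖ < ε) ∧ ‖x i‖ - ε < ‖Ψ (x i)‖) :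
    InnerQuasidiagonal B := by
  intro n x ε hε
  let _ := CStarAlgebra.spectralOrder B
  have := CStarAlgebra.spectralOrderedRing B
  obtain ⟨C, _, _, _, _, Ψ, D, hΨ_nonneg, hΨ_one, hD, hx⟩ := h n x (ε / 6) (by positivity)
  choose d hdD hd using fun i => (hx i).1
  let Φ := positiveOfStarMulSelf Ψ hΨ_nonneg
  have hΦ : ‖Φ 1‖ ≤ 1 := by
    rw [positiveOfStarMulSelf_apply, hΨ_one]
    exact (CStarAlgebra.norm_le_one_iff_of_nonneg 1).mpr le_rfl
  obtain ⟨H, _, _, _, ρ, P, hP, hP_finite, hP_mem, hP_comm, hP_norm⟩ :=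
    exists_rep_norm_le_norm_compression (Ψ := Φ) hΨ_one hD hdD
  refine ⟨H, _, _, _, (ρ : B →⋆ₙₐ[ℂ] _), P, hP, hP_finite, hP_mem, fun i => ?_⟩
  have hρ : ‖ρ (x i) - ρ (d i)‖ ≤ ‖x i - d i‖ := by
    simpa using NonUnitalStarAlgHom.norm_apply_le ρ (x i - d i)
  have hcomm := norm_commutator_le_of_commute (a := ρ (x i)) hP.norm_le (hP_comm _ (hdD i))
  have hcompr := norm_compression_le_add hP.norm_le (ρ (x i)) (ρ (d i))
  have hΨ : ‖Ψ (x i)‖ ≤ ‖Ψ (d i)‖ + 4 * ‖x i - d i‖ := calc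
    ‖Ψ (x i)‖ ≤ ‖Ψ (d i)‖ + ‖Φ (x i - d i)‖ := by
      simpa [Φ] using norm_le_norm_add_norm_sub' (Ψ (x i)) (Ψ (d i))
    _ ≤ ‖Ψ (d i)‖ + 4 * ‖x i - d i‖ := by gcongr; exact norm_map_le_four_mul_norm Φ hΦ _
  have hPi : ‖Ψ (d i)‖ ≤ ‖P * ρ (d i) * P‖ := hP_norm i
  change ‖P * ρ (x i) - ρ (x i) * P‖ < ε ∧ ‖x i‖ - ε < ‖P * ρ (x i) * P‖
  constructor <;> linarith [hd i, (hx i).2]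

end Criterion

section MultiplicativeDomain

variable {A : Type*} [CStarAlgebra A] [PartialOrder A] [StarOrderedRing A]
  {C : Type*} [CStarAlgebra C] [PartialOrder C] [StarOrderedRing C]

lemma mul_eq_zero_of_star_mul_mul_eq_zero {x p : C} (hx : 0 ≤ x) (hp : star p * x * p = 0) :
    x * p = 0 := by
  obtain ⟨y, rfl⟩ := CStarAlgebra.nonneg_iff_eq_star_mul_self.mp hx
  have hyp : y * p = 0 := (CStarRing.star_mul_self_eq_zero_iff _).mp (by
    rw [star_mul, mul_assoc, ← mul_assoc (star y), ← mul_assoc, hp])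
  rw [mul_assoc, hyp, mul_zero]

/- Choi's theorem. For the row `R = (a, 1, b⋆)` and the column `p = (1, -φ(a), 0)` the positive
matrix `N = φ(R⋆ R)` satisfies `p⋆ N p = φ(a⋆ a) - φ(a)⋆ φ(a) = 0`, hence `N p = 0`, whose last
entry is `φ(b a) - φ(b) φ(a)`. -/
lemma map_mul_of_map_star_mul_self {φ : A →CP C} (hφ : φ 1 = 1) {a : A}
    (ha : φ (star a * a) = star (φ a) * φ a) (b : A) : φ (b * a) = φ b * φ a := by
  have hstar (x) : φ (star x) = star (φ x) := map_star φ x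
  let R : CStarMatrix (Fin 3) (Fin 3) A :=
    CStarMatrix.ofMatrix !![a, 1, star b; 0, 0, 0; 0, 0, 0]
  let N : CStarMatrix (Fin 3) (Fin 3) C := (star R * R).map φ
  let p : CStarMatrix (Fin 3) (Fin 3) C := CStarMatrix.ofMatrix !![1, 0, 0; -φ a, 0, 0; 0, 0, 0]
  have hN : 0 ≤ N := φ.map_cstarMatrix_nonneg (star R * R) (star_mul_self_nonneg R)
  have hp : star p * N * p = 0 := by
    ext i j
    fin_cases i <;> fin_cases j <;>
      simp [CStarMatrix.mul_apply, CStarMatrix.star_apply, Fin.sum_univ_three, R, N, p, ha, hφ,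
        hstar]
  have hNp : (N * p) 2 0 = φ (b * a) - φ b * φ a := by
    simp [CStarMatrix.mul_apply, CStarMatrix.star_apply, Fin.sum_univ_three, R, N, p,
      sub_eq_add_neg]
  rw [← sub_eq_zero, ← hNp, mul_eq_zero_of_star_mul_mul_eq_zero hN hp, CStarMatrix.zero_apply]

lemma mem_multiplicativeDomain_iff {φ : A →CP C} (hφ : φ 1 = 1) {a : A} :
    a ∈ multiplicativeDomain φ ↔ ∀ b, φ (a * b) = φ a * φ b ∧ φ (b * a) = φ b * φ a := by
  refine ⟨fun ha b => ⟨?_, map_mul_of_map_star_mul_self hφ ha.1 b⟩, fun h => ⟨?_, ?_⟩⟩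
  · have hmul := congrArg star (map_mul_of_map_star_mul_self hφ (a := star a)
      (by simpa [map_star] using ha.2) (star b))
    simpa [← map_star] using hmul
  · rw [(h (star a)).2, map_star]
  · rw [(h (star a)).1, map_star]

/-- The multiplicative domain of a unital completely positive map, as a ⋆-subalgebra. -/
def multiplicativeDomainSubalgebra (φ : A →CP C) (hφ : φ 1 = 1) : StarSubalgebra ℂ A where
  carrier := multiplicativeDomain φ
  mul_mem' {a b} ha hb := by
    rw [mem_multiplicativeDomain_iff hφ] at *
    intro c
    constructor
    · rw [mul_assoc, (ha _).1, (hb _).1, (ha _).1, mul_assoc]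
    · rw [← mul_assoc, (hb _).2, (ha _).2, (ha _).1, mul_assoc]
  add_mem' {a b} ha hb := by
    rw [mem_multiplicativeDomain_iff hφ] at *
    simp_all [add_mul, mul_add]
  algebraMap_mem' c := by
    simp [mem_multiplicativeDomain_iff hφ, Algebra.algebraMap_eq_smul_one, hφ]
  star_mem' ha := by
    simpa [multiplicativeDomain, map_star, and_comm] using ha

end MultiplicativeDomain

section LowerLimit

variable {ι : Type*} {l : Filter ι}

section Sets

variable {X Y : Type*} [TopologicalSpace X] [TopologicalSpace Y]

/-- The Kuratowski lower limit of a family of sets along a filter: the points all of whose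
neighbourhoods eventually meet the members of the family. -/
def lowerLimitSet (l : Filter ι) (S : ι → Set X) : Set X :=
  {x | ∀ U ∈ 𝓝 x, ∀ᶠ i in l, (U ∩ S i).Nonempty}

lemma isClosed_lowerLimitSet (S : ι → Set X) : IsClosed (lowerLimitSet l S) := by
  refine isClosed_of_closure_subset fun x hx U hU => ?_
  obtain ⟨V, hVU, hV, hxV⟩ := mem_nhds_iff.mp hU
  obtain ⟨y, hyV, hy⟩ := mem_closure_iff.mp hx V hV hxV
  exact (hy V (hV.mem_nhds hyV)).mono fun i hi => hi.mono (Set.inter_subset_inter_left _ hVU)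

lemma mem_lowerLimitSet_of_forall_mem {S : ι → Set X} {x : X} (hx : ∀ i, x ∈ S i) :
    x ∈ lowerLimitSet l S :=
  fun _ hU => .of_forall fun i => ⟨x, mem_of_mem_nhds hU, hx i⟩

lemma map_mem_lowerLimitSet {S : ι → Set X} {T : ι → Set Y} {f : X → Y} (hf : Continuous f)
    (hST : ∀ i, Set.MapsTo f (S i) (T i)) {x : X} (hx : x ∈ lowerLimitSet l S) :
    f x ∈ lowerLimitSet l T := fun _ hU =>
  (hx _ (hf.tendsto x hU)).mono fun i ⟨y, hyU, hyS⟩ => ⟨f y, hyU, hST i hyS⟩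

lemma prodMk_mem_lowerLimitSet {S : ι → Set X} {T : ι → Set Y} {x : X} {y : Y}
    (hx : x ∈ lowerLimitSet l S) (hy : y ∈ lowerLimitSet l T) :
    (x, y) ∈ lowerLimitSet l fun i => S i ×ˢ T i := fun U hU => by
  obtain ⟨V, hV, W, hW, hVW⟩ := mem_nhds_prod_iff.mp hU
  filter_upwards [hx V hV, hy W hW] with i hVS hWT
  exact ((hVS.prod hWT).mono Set.prod_inter_prod.ge).mono (Set.inter_subset_inter_left _ hVW)

lemma pi_mem_lowerLimitSet {κ : Type*} [Finite κ] {Z : κ → Type*} [∀ j, TopologicalSpace (Z j)]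
    {S : ∀ j, ι → Set (Z j)} {x : ∀ j, Z j} (hx : ∀ j, x j ∈ lowerLimitSet l (S j)) :
    x ∈ lowerLimitSet l fun i => Set.univ.pi fun j => S j i := fun U hU => by
  rw [nhds_pi, Filter.mem_pi'] at hU
  obtain ⟨J, V, hV, hVU⟩ := hU
  filter_upwards [eventually_all.mpr fun j => hx j (V j) (hV j)] with i hi
  choose y hy using hi
  exact ⟨y, hVU fun j _ => (hy j).1, fun j _ => (hy j).2⟩

end Sets

lemma mem_lowerLimitSet_iff_dist {X : Type*} [PseudoMetricSpace X] {S : ι → Set X} {x : X} :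
    x ∈ lowerLimitSet l S ↔ ∀ ε > 0, ∀ᶠ i in l, ∃ y ∈ S i, dist x y < ε := by
  refine ⟨fun hx ε hε => ?_, fun h U hU => ?_⟩
  · filter_upwards [hx _ (Metric.ball_mem_nhds x hε)] with i ⟨y, hyx, hyS⟩
    exact ⟨y, hyS, Metric.mem_ball'.mp hyx⟩
  · obtain ⟨ε, hε, hεU⟩ := Metric.mem_nhds_iff.mp hU
    filter_upwards [h ε hε] with i ⟨y, hyS, hxy⟩
    exact ⟨y, hεU (Metric.mem_ball'.mpr hxy), hyS⟩

lemma mem_lowerLimitSet_of_tendsto_infDist {X : Type*} [PseudoMetricSpace X] {S : ι → Set X}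
    (hS : ∀ i, (S i).Nonempty) {x : X} (hx : Tendsto (fun i => Metric.infDist x (S i)) l (𝓝 0)) :
    x ∈ lowerLimitSet l S := mem_lowerLimitSet_iff_dist.mpr fun _ hε =>
  (hx.eventually_lt_const hε).mono fun i hi => (Metric.infDist_lt_iff (hS i)).mp hi

variable {F : Type*} [TopologicalSpace F] [Semiring F] [StarRing F] [Algebra ℂ F] [StarModule ℂ F]
  [IsTopologicalSemiring F] [ContinuousStar F]

/-- The Kuratowski lower limit of a family of ⋆-subalgebras, as a ⋆-subalgebra. -/
def lowerLimit (l : Filter ι) (D : ι → StarSubalgebra ℂ F) : StarSubalgebra ℂ F where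
  carrier := lowerLimitSet l fun i => D i
  mul_mem' hx hy := map_mem_lowerLimitSet continuous_mul
    (fun i _ hp => (D i).mul_mem hp.1 hp.2) (prodMk_mem_lowerLimitSet hx hy)
  add_mem' hx hy := map_mem_lowerLimitSet continuous_add
    (fun i _ hp => (D i).add_mem hp.1 hp.2) (prodMk_mem_lowerLimitSet hx hy)
  algebraMap_mem' c := mem_lowerLimitSet_of_forall_mem fun i => algebraMap_mem (D i) c
  star_mem' hx := map_mem_lowerLimitSet continuous_star (fun _ _ hx => star_mem hx) hx

end LowerLimit

section EntriesIn

variable {A G : Type*} [CStarAlgebra A]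

/-- The ⋆-subalgebra `M_G(D)` of matrices with entries in a ⋆-subalgebra `D`. -/
def entriesIn (G : Type*) [Fintype G] [DecidableEq G] (D : StarSubalgebra ℂ A) :
    StarSubalgebra ℂ (CStarMatrix G G A) where
  carrier := {M | ∀ s t, M s t ∈ D}
  mul_mem' hM hN s t := by
    rw [CStarMatrix.mul_apply]
    exact sum_mem fun u _ => mul_mem (hM s u) (hN u t)
  add_mem' hM hN s t := add_mem (hM s t) (hN s t)
  algebraMap_mem' c s t := by
    rw [Algebra.algebraMap_eq_smul_one, CStarMatrix.smul_apply, CStarMatrix.one_apply]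
    split_ifs
    · exact D.smul_mem (one_mem D) c
    · exact D.smul_mem (zero_mem D) c
  star_mem' hM s t := by
    rw [CStarMatrix.star_apply]
    exact star_mem (hM t s)

lemma continuous_cstarMatrix {X : Type*} [TopologicalSpace X] {f : X → CStarMatrix G G A}
    (hf : ∀ s t, Continuous fun x => f x s t) : Continuous f :=
  continuous_pi fun s => continuous_pi fun t => hf s t

lemma mem_lowerLimit_entriesIn [PartialOrder A] [StarOrderedRing A] [Fintype G] [DecidableEq G]
    {ι : Type*} {l : Filter ι} {D : ι → StarSubalgebra ℂ A} {M : CStarMatrix G G A}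
    (hM : ∀ s t, M s t ∈ lowerLimit l D) : M ∈ lowerLimit l fun i => entriesIn G (D i) :=
  map_mem_lowerLimitSet (S := fun i => Set.univ.pi fun _ : G × G => (D i : Set A))
    (T := fun i => (entriesIn G (D i) : Set (CStarMatrix G G A)))
    (f := fun e : G × G → A => CStarMatrix.ofMatrix fun s t => e (s, t))
    (continuous_cstarMatrix fun s t => continuous_apply (s, t))
    (fun _ _ he s t => he (s, t) trivial)
    (pi_mem_lowerLimitSet (x := fun p : G × G => M p.1 p.2) fun p => hM p.1 p.2)

end EntriesIn

section CrossedProductApproximation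

variable {A : Type*} [CStarAlgebra A] {G : Type*} [Group G] [DecidableEq G]

lemma continuous_covariantCoeff (α : G →* (A ≃⋆ₐ[ℂ] A)) : Continuous (covariantCoeff α) := by
  refine continuous_cstarMatrix fun s t => ?_
  rcases eq_or_ne s t with rfl | hst
  · simpa [covariantCoeff] using
      (NonUnitalStarAlgHom.isometry ((α s)⁻¹ : A ≃⋆ₐ[ℂ] A) (EquivLike.injective _)).continuous
  · simpa [covariantCoeff, hst] using continuous_const

variable [Fintype G]

lemma covariantCoeff_mem_entriesIn {α : G →* (A ≃⋆ₐ[ℂ] A)} {D : StarSubalgebra ℂ A}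
    (hα : ∀ g, Set.MapsTo (α g) D D) {a : A} (ha : a ∈ D) :
    covariantCoeff α a ∈ entriesIn G D := by
  intro s t
  rcases eq_or_ne s t with rfl | hst
  · simpa [covariantCoeff, ← map_inv] using hα s⁻¹ ha
  · simp [covariantCoeff, hst]

lemma covariantUnitary_mem_entriesIn (D : StarSubalgebra ℂ A) (h : G) :
    covariantUnitary A h ∈ entriesIn G D := by
  intro s t
  by_cases hst : s = h * t <;> simp [covariantUnitary, hst]

variable [PartialOrder A] [StarOrderedRing A]

lemma covariantCoeff_mem_crossedProduct (α : G →* (A ≃⋆ₐ[ℂ] A)) (a : A) :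
    covariantCoeff α a ∈ CrossedProduct α :=
  StarSubalgebra.le_topologicalClosure _ (StarAlgebra.subset_adjoin ℂ _ (.inl ⟨a, rfl⟩))

lemma covariantUnitary_mem_crossedProduct (α : G →* (A ≃⋆ₐ[ℂ] A)) (h : G) :
    covariantUnitary A h ∈ CrossedProduct α :=
  StarSubalgebra.le_topologicalClosure _ (StarAlgebra.subset_adjoin ℂ _ (.inr ⟨h, rfl⟩))

theorem crossedProduct_le_lowerLimit {ι : Type*} {l : Filter ι} {α : G →* (A ≃⋆ₐ[ℂ] A)}
    {D : ι → StarSubalgebra ℂ A}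
    (hα : ∀ i g, Set.MapsTo (α g) (D i) (D i)) (hD : ∀ a, a ∈ lowerLimit l D) :
    CrossedProduct α ≤ lowerLimit l fun i => CrossedProduct α ⊓ entriesIn G (D i) := by
  refine StarSubalgebra.topologicalClosure_minimal (StarAlgebra.adjoin_le ?_)
    (isClosed_lowerLimitSet _)
  rintro _ (⟨a, rfl⟩ | ⟨h, rfl⟩)
  · have hcoeff (i) : Set.MapsTo (covariantCoeff α) (D i) ↑(CrossedProduct α ⊓ entriesIn G (D i)) :=
      fun b hb => ⟨covariantCoeff_mem_crossedProduct α b, covariantCoeff_mem_entriesIn (hα i) hb⟩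
    exact map_mem_lowerLimitSet (continuous_covariantCoeff α) hcoeff (hD a)
  · exact mem_lowerLimitSet_of_forall_mem fun i =>
      ⟨covariantUnitary_mem_crossedProduct α h, covariantUnitary_mem_entriesIn (D i) h⟩

end CrossedProductApproximation

section AlmostIsometric

variable {F : Type*} [CStarAlgebra F] [PartialOrder F] [StarOrderedRing F]

lemma exists_ne_zero_smul_star_mul_self_le {x : F} {c : ℝ} (hc : 0 ≤ c) (hcx : c < ‖star x * x‖) :
    ∃ z ≠ 0, c • (star z * z) ≤ star (x * z) * (x * z) := by
  set a := star x * x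
  have ha : 0 ≤ a := star_mul_self_nonneg x
  have : Nontrivial F := nontrivial_of_ne a 0 (norm_pos_iff.mp (hc.trans_lt hcx))
  let g : ℝ → ℝ := fun t => max (t - c) 0
  have : Continuous g := by fun_prop
  have hz : star (cfc g a) = cfc g a := (cfc_predicate g a).star_eq
  refine ⟨cfc g a, fun h => ?_, ?_⟩
  · have hnorm := norm_apply_le_norm_cfc g a (CStarAlgebra.norm_mem_spectrum_of_nonneg ha)
    rw [h, norm_zero, Real.norm_of_nonneg (le_max_right _ _)] at hnorm
    linarith [le_max_left (‖a‖ - c) 0]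
  · calc c • (star (cfc g a) * cfc g a) = cfc (fun t => c * (g t * g t)) a := by
          rw [hz, ← cfc_mul g g a, ← cfc_const_mul c _ a]
      _ ≤ cfc (fun t => g t * t * g t) a := cfc_mono fun t _ => by
          rcases le_total t c with htc | hct
          · simp [g, htc]
          · nlinarith [mul_self_nonneg (g t)]
      _ = star (x * cfc g a) * (x * cfc g a) := by
          rw [star_mul, hz, mul_assoc, ← mul_assoc (star x), ← mul_assoc, cfc_mul _ _ a,
            cfc_mul _ _ a, cfc_id' ℝ a]

lemma norm_le_of_monotone_cstarNorm (p : F → ℝ) (p_nonneg : ∀ y, 0 ≤ p y)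
    (p_mul : ∀ y z, p (y * z) ≤ p y * p z) (p_star : ∀ y, p (star y * y) = p y ^ 2)
    (p_smul : ∀ r : ℝ, 0 ≤ r → ∀ y, p (r • y) = r * p y)
    (p_mono : ∀ ⦃y z⦄, 0 ≤ y → y ≤ z → p y ≤ p z) (p_pos : ∀ z ≠ 0, 0 < p z) (x : F) :
    ‖x‖ ≤ p x := by
  by_contra! hlt
  have hsq : p x ^ 2 < ‖star x * x‖ := by
    rw [CStarRing.norm_star_mul_self, ← sq]
    gcongr
    exact p_nonneg x
  obtain ⟨e, hpe, hex⟩ := exists_between hsq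
  have he : 0 ≤ e := (sq_nonneg _).trans hpe.le
  obtain ⟨z, hz, hle⟩ := exists_ne_zero_smul_star_mul_self_le he hex
  have hpz : e * p z ^ 2 ≤ p x ^ 2 * p z ^ 2 := calc
    e * p z ^ 2 = p (e • (star z * z)) := by rw [p_smul e he, p_star]
    _ ≤ p (star (x * z) * (x * z)) := p_mono (smul_nonneg he (star_mul_self_nonneg z)) hle
    _ = p (x * z) ^ 2 := p_star _
    _ ≤ (p x * p z) ^ 2 := by gcongr; exacts [p_nonneg _, p_mul x z]
    _ = p x ^ 2 * p z ^ 2 := mul_pow _ _ _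
  exact hpe.not_ge (le_of_mul_le_mul_right hpz (pow_pos (p_pos z hz) 2))

variable {ι : Type*} {C : ι → Type*} [∀ i, CStarAlgebra (C i)] [∀ i, PartialOrder (C i)]
  [∀ i, StarOrderedRing (C i)]

lemma exists_tendsto_norm_map (U : Ultrafilter ι) (Ψ : ∀ i, F →ₚ[ℂ] C i)
    (hΨ : ∀ i, ‖Ψ i 1‖ ≤ 1) (y : F) : ∃ r, Tendsto (fun i => ‖Ψ i y‖) U (𝓝 r) := by
  obtain ⟨r, -, hr⟩ := isCompact_Icc.ultrafilter_le_nhds' (U.map fun i => ‖Ψ i y‖)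
    (Filter.mem_map.mpr (univ_mem' fun i =>
      ⟨norm_nonneg _, norm_map_le_four_mul_norm (Ψ i) (hΨ i) y⟩))
  exact ⟨r, hr⟩

/- Along an ultrafilter the limit of `‖Ψ i ·‖` is a second C⋆-norm, and C⋆-norms are unique. -/
theorem eventually_lt_norm_of_asymptotically_multiplicative {l : Filter ι}
    {Ψ : ∀ i, F →ₚ[ℂ] C i} (hΨ : ∀ i, ‖Ψ i 1‖ ≤ 1)
    (hpos : ∀ z ≠ 0, ∃ δ > 0, ∀ᶠ i in l, δ ≤ ‖Ψ i z‖)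
    (hmul : ∀ y z, Tendsto (fun i => ‖Ψ i (y * z) - Ψ i y * Ψ i z‖) l (𝓝 0))
    {x : F} {c : ℝ} (hc : c < ‖x‖) : ∀ᶠ i in l, c < ‖Ψ i x‖ := by
  by_contra hcon
  have : (l ⊓ 𝓟 {i | ‖Ψ i x‖ ≤ c}).NeBot :=
    frequently_mem_iff_neBot.mp ((not_eventually.mp hcon).mono fun i => le_of_not_gt)
  let U := Ultrafilter.of (l ⊓ 𝓟 {i | ‖Ψ i x‖ ≤ c})
  have hUl : (U : Filter ι) ≤ l := (Ultrafilter.of_le _).trans inf_le_left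
  have hUx : ∀ᶠ i in U, ‖Ψ i x‖ ≤ c :=
    (Ultrafilter.of_le _).trans inf_le_right (mem_principal_self _)
  choose p hp using exists_tendsto_norm_map U Ψ hΨ
  have hp_mul (y z) : Tendsto (fun i => ‖Ψ i y * Ψ i z‖) U (𝓝 (p (y * z))) := by
    refine (hp (y * z)).congr_dist (squeeze_zero (fun _ => dist_nonneg) (fun i => ?_)
      ((hmul y z).mono_left hUl))
    exact dist_norm_norm_le _ _
  refine hc.not_ge ((norm_le_of_monotone_cstarNorm p ?_ ?_ ?_ ?_ ?_ ?_ x).trans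
    (le_of_tendsto (hp x) hUx))
  · exact fun y => ge_of_tendsto' (hp y) fun i => norm_nonneg _
  · exact fun y z => le_of_tendsto_of_tendsto' (hp_mul y z) ((hp y).mul (hp z)) fun i =>
      norm_mul_le _ _
  · refine fun y => tendsto_nhds_unique (hp_mul (star y) y) (((hp y).pow 2).congr fun i => ?_)
    rw [map_star, CStarRing.norm_star_mul_self, sq]
  · refine fun r hr y => tendsto_nhds_unique (hp _) (((hp y).const_mul r).congr fun i => ?_)
    rw [← Complex.coe_smul, map_smul, norm_smul, Complex.norm_real, Real.norm_of_nonneg hr]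
  · exact fun y z hy hyz => le_of_tendsto_of_tendsto' (hp y) (hp z) fun i =>
      CStarAlgebra.norm_le_norm_of_nonneg_of_le (map_nonneg (Ψ i) hy) (OrderHomClass.mono (Ψ i) hyz)
  · intro z hz
    obtain ⟨δ, hδ, hδz⟩ := hpos z hz
    exact hδ.trans_le (ge_of_tendsto (hp z) (hUl hδz))

lemma tendsto_norm_map_mul_sub {l : Filter ι} {Ψ : ∀ i, F →ₚ[ℂ] C i} (hΨ : ∀ i, ‖Ψ i 1‖ ≤ 1)
    {D : ι → Set F} (hD : ∀ i x, ∀ d ∈ D i, Ψ i (x * d) = Ψ i x * Ψ i d) (x : F) {y : F}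
    (hy : y ∈ lowerLimitSet l D) :
    Tendsto (fun i => ‖Ψ i (x * y) - Ψ i x * Ψ i y‖) l (𝓝 0) := by
  rw [Metric.tendsto_nhds]
  intro ε hε
  filter_upwards [mem_lowerLimitSet_iff_dist.mp hy (ε / (20 * ‖x‖ + 1)) (by positivity)]
    with i ⟨d, hd, hyd⟩
  rw [Real.dist_0_eq_abs, abs_norm]
  calc ‖Ψ i (x * y) - Ψ i x * Ψ i y‖ ≤ 20 * ‖x‖ * ‖y - d‖ :=
        norm_map_mul_sub_le (Ψ i) (hΨ i) (hD i x d hd) y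
    _ ≤ (20 * ‖x‖ + 1) * ‖y - d‖ := by gcongr; linarith
    _ < ε := by rwa [← dist_eq_norm, ← lt_div_iff₀' (by positivity)]

end AlmostIsometric

section Amplification

variable {G : Type*} [Fintype G]
  {A : Type*} [CStarAlgebra A] [PartialOrder A] [StarOrderedRing A]

section Single

variable {C : Type*} [CStarAlgebra C] [PartialOrder C] [StarOrderedRing C] {φ : A →CP C}

/-- The entrywise action of a completely positive map on matrices indexed by `G`. -/
noncomputable def amplify (G : Type*) [Fintype G] (φ : A →CP C) :
    CStarMatrix G G A →ₚ[ℂ] CStarMatrix G G C :=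
  .mk₀ (CStarMatrix.mapₗ φ.toLinearMap) fun M hM => φ.map_cstarMatrix_nonneg M hM

lemma amplify_apply (φ : A →CP C) (M : CStarMatrix G G A) (s t : G) :
    amplify G φ M s t = φ (M s t) := rfl

variable [DecidableEq G]

lemma amplify_one (hφ : φ 1 = 1) : amplify G φ 1 = 1 := by
  ext s t
  rw [amplify_apply, CStarMatrix.one_apply, CStarMatrix.one_apply]
  split_ifs <;> simp [hφ]

lemma amplify_mul (hφ : φ 1 = 1) (M : CStarMatrix G G A) {N : CStarMatrix G G A}
    (hN : N ∈ entriesIn G (multiplicativeDomainSubalgebra φ hφ)) :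
    amplify G φ (M * N) = amplify G φ M * amplify G φ N := by
  ext s t
  simp only [amplify_apply, CStarMatrix.mul_apply, map_sum]
  exact Finset.sum_congr rfl fun u _ => ((mem_multiplicativeDomain_iff hφ).mp (hN u t) _).2

lemma norm_amplify_one_le (hφ : φ 1 = 1) : ‖amplify G φ 1‖ ≤ 1 := by
  rw [amplify_one hφ]
  exact (CStarAlgebra.norm_le_one_iff_of_nonneg 1).mpr le_rfl

end Single

variable {ι : Type*} {l : Filter ι} {C : ι → Type*} [∀ i, CStarAlgebra (C i)]
  [∀ i, PartialOrder (C i)] [∀ i, StarOrderedRing (C i)] {φ : ∀ i, A →CP C i}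

theorem eventually_lt_norm_amplify (hφ : ∀ i, φ i 1 = 1)
    (hnorm : ∀ a, Tendsto (fun i => ‖φ i a‖) l (𝓝 ‖a‖))
    (hD : ∀ a, a ∈ lowerLimit l fun i => multiplicativeDomainSubalgebra (φ i) (hφ i))
    {x : CStarMatrix G G A} {c : ℝ} (hc : c < ‖x‖) : ∀ᶠ i in l, c < ‖amplify G (φ i) x‖ := by
  classical
  refine eventually_lt_norm_of_asymptotically_multiplicative
    (fun i => norm_amplify_one_le (hφ i)) (fun z hz => ?_) (fun y z => ?_) hc
  · obtain ⟨s, t, hst⟩ : ∃ s t, z s t ≠ 0 := by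
      by_contra! h
      exact hz (CStarMatrix.ext h)
    have hpos : 0 < ‖z s t‖ := norm_pos_iff.mpr hst
    refine ⟨‖z s t‖ / 2, half_pos hpos, ?_⟩
    filter_upwards [(hnorm (z s t)).eventually_const_lt (half_lt_self hpos)] with i hi
    exact hi.le.trans (CStarMatrix.norm_entry_le_norm (M := amplify G (φ i) z))
  · exact tendsto_norm_map_mul_sub (fun i => norm_amplify_one_le (hφ i))
      (fun i y d hd => amplify_mul (hφ i) y hd) y
      (mem_lowerLimit_entriesIn fun s t => hD (z s t))

end Amplification

instance moduleFinite_cstarMatrix {m n : Type*} [Finite m] [Finite n] {R M : Type*} [Semiring R]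
    [AddCommMonoid M] [Module R M] [Module.Finite R M] : Module.Finite R (CStarMatrix m n M) :=
  inferInstanceAs (Module.Finite R (m → n → M))

theorem mainTheorem5_general {A : Type*} [CStarAlgebra A] [PartialOrder A] [StarOrderedRing A]
    {G : Type*} [Group G] [Fintype G] [DecidableEq G] (α : G →* (A ≃⋆ₐ[ℂ] A))
    {ι : Type*} {l : Filter ι} [l.NeBot] {C : ι → Type*} [∀ i, CStarAlgebra (C i)]
    [∀ i, PartialOrder (C i)] [∀ i, StarOrderedRing (C i)] [∀ i, FiniteDimensional ℂ (C i)]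
    (φ : ∀ i, A →CP C i) (hφ_unital : ∀ i, φ i 1 = 1)
    (hφ_norm : ∀ a, Tendsto (fun i => ‖φ i a‖) l (𝓝 ‖a‖))
    (hφ_dist : ∀ a, Tendsto (fun i => Metric.infDist a (multiplicativeDomain (φ i))) l (𝓝 0))
    (hα : ∀ i g, Set.MapsTo (α g) (multiplicativeDomain (φ i)) (multiplicativeDomain (φ i))) :
    InnerQuasidiagonal (CrossedProduct α) := by
  let D i := multiplicativeDomainSubalgebra (φ i) (hφ_unital i)
  have hD (a) : a ∈ lowerLimit l D :=
    mem_lowerLimitSet_of_tendsto_infDist (fun i => ⟨1, one_mem (D i)⟩) (hφ_dist a)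
  refine innerQuasidiagonal_of_exists_positive fun n x ε hε => ?_
  have happrox (j) : ∀ᶠ i in l,
      ∃ d ∈ CrossedProduct α ⊓ entriesIn G (D i), dist (x j : CStarMatrix G G A) d < ε :=
    mem_lowerLimitSet_iff_dist.mp (crossedProduct_le_lowerLimit hα hD (x j).2) ε hε
  have hlower (j) : ∀ᶠ i in l, ‖x j‖ - ε < ‖amplify G (φ i) (x j)‖ :=
    eventually_lt_norm_amplify hφ_unital hφ_norm hD (sub_lt_self _ hε)
  obtain ⟨i, hi⟩ := (eventually_all.mpr fun j => (happrox j).and (hlower j)).exists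
  refine ⟨CStarMatrix G G (C i), inferInstance, inferInstance, inferInstance, inferInstance,
    (amplify G (φ i)).toLinearMap ∘ₗ (CrossedProduct α).subtype.toAlgHom.toLinearMap,
    (entriesIn G (D i)).comap (CrossedProduct α).subtype,
    fun b => map_nonneg (amplify G (φ i)) (star_mul_self_nonneg (b : CStarMatrix G G A)),
    amplify_one (hφ_unital i), fun d _ e he => amplify_mul (hφ_unital i) d.1 he,
    fun j => ⟨?_, (hi j).2⟩⟩
  obtain ⟨d, ⟨hdα, hdD⟩, hd⟩ := (hi j).1
  exact ⟨⟨d, hdα⟩, hdD, by rwa [dist_eq_norm] at hd⟩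

theorem mainTheorem5 {A : Type*} [CStarAlgebra A] [PartialOrder A] [StarOrderedRing A]
    [TopologicalSpace.SeparableSpace A]
    {G : Type*} [Group G] [Fintype G] [DecidableEq G]
    (α : G →* (A ≃⋆ₐ[ℂ] A))
    (k : ℕ → ℕ) (φ : ∀ n, A →CP MatrixAlgebra (k n))
    (hφ_unital : ∀ n, φ n 1 = 1)
    (hφ_norm : ∀ a : A, Tendsto (fun n => ‖φ n a‖) atTop (𝓝 ‖a‖))
    (hφ_dist : ∀ a : A,
      Tendsto (fun n => Metric.infDist a (multiplicativeDomain (φ n))) atTop (𝓝 0))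
    (hα : ∀ (n : ℕ) (g : G), α g '' multiplicativeDomain (φ n) = multiplicativeDomain (φ n)) :
    InnerQuasidiagonal (CrossedProduct α) :=
  mainTheorem5_general α φ hφ_unital hφ_norm hφ_dist fun n g =>
    Set.mapsTo_iff_image_subset.mpr (hα n g).le
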